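/- For integers $s,t\ge 0$, an $s \pmod t$-core is an integer partition none of whose hook lengths (in its Young diagram) lies in $\{s, s+t, s+2t, \dots\}$, and $c_{s(t)}(n)$ denotes the number of partitions of $n$ that are $s \pmod t$-cores. Then, for all integers $n\ge 0$, $$c_{6(9)}(16n+9)\equiv 0 \pmod 2,$$ and, for every $k\in\{38, 88, 118, 168, 198, 248, 278, 328\}$ and all integers $n\ge 0$, $$c_{6(9)}(400n+k)\equiv 0 \pmod 3.$$ -/

import Mathlib

/-- The Young (Ferrers) diagram of a partition of `n`: its row lengths are the parts in weakly
decreasing order. -/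
def Nat.Partition.diagram {n : ℕ} (p : n.Partition) : YoungDiagram :=
  YoungDiagram.ofRowLens (p.parts.sort (· ≥ ·)) (p.parts.pairwise_sort (· ≥ ·)).sortedGE

/-- The hook length of the box `(i, j)` (row `i`, column `j`) of `μ`: the number of boxes strictly
to its right in its row, plus the number of boxes strictly below it in its column, plus `1`.
It is only used for boxes of `μ`, where no subtraction truncates. -/
def YoungDiagram.hookLength (μ : YoungDiagram) (i j : ℕ) : ℕ :=
  (μ.rowLen i - (j + 1)) + (μ.colLen j - (i + 1)) + 1

/-- `p` is an `s (mod t)`-core: a simultaneous `(s, s + t, s + 2t, …)`-core, that is, no box of its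
diagram has hook length `s + k * t` with `k ≥ 0`. -/
def Nat.Partition.IsModCore {n : ℕ} (s t : ℕ) (p : n.Partition) : Prop :=
  ∀ i j : ℕ, (i, j) ∈ p.diagram → ∀ k : ℕ, p.diagram.hookLength i j ≠ s + k * t

/-- `c_{s(t)}(n)`: the number of partitions of `n` that are `s (mod t)`-cores. -/
noncomputable def numModCores (s t n : ℕ) : ℕ :=
  Nat.card {p : n.Partition // p.IsModCore s t}

/-! ### Partitions and their Young diagrams -/

/-! Encode a partition by its Maya diagram: each row gives a bead in ℤ, each column a gap, and hook
lengths are the differences bead minus gap. Being a 6 (mod 9)-core means that the bead set is closed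
under subtracting 6, 15, 24, … (`Nat.Partition.isModCore_iff`). These are 3 times 2, 5, 8, …, so the
three residue classes mod 3 decouple, and each is a shifted 2 (mod 3)-core, of which there are only
∅, (1), (2,1) (`exists_coreRunner_eq`). Cores of n thus correspond to two free charges a, b and
three shapes with `latticeEnergy` equal to n (`nonempty_modCores_equiv_lattice`).

The congruences come from symmetries of this energy, an involution and a rotation of order 3, which
have no fixed points at the given n. At a fixed point, 3n + 1 minus 9 times the total shape size is
a square (mod 2 case) or an Eisenstein norm (mod 3 case), which residues mod 16 or 25 forbid. -/

theorem Nat.Partition.rowLens_diagram {n : ℕ} (p : n.Partition) :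
    p.diagram.rowLens = p.parts.sort (· ≥ ·) :=
  YoungDiagram.rowLens_ofRowLens_eq_self fun x hx => p.parts_pos (by simpa using hx)

theorem Nat.Partition.diagram_injective {n : ℕ} :
    Function.Injective (Nat.Partition.diagram (n := n)) := by
  intro p q h
  have h' := congrArg (fun μ => (μ.rowLens : Multiset ℕ)) h
  simp only [Nat.Partition.rowLens_diagram, Multiset.sort_eq] at h'
  exact Nat.Partition.ext h'

theorem Nat.Partition.sum_rowLen_diagram {n : ℕ} (p : n.Partition) :
    ∑ i ∈ Finset.range (p.diagram.colLen 0), p.diagram.rowLen i = n := by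
  have h : p.diagram.rowLens.sum = n := by
    rw [p.rowLens_diagram, ← Multiset.sum_coe, Multiset.sort_eq, p.parts_sum]
  rwa [YoungDiagram.rowLens, ← Multiset.sum_coe, ← Multiset.map_coe] at h

theorem Nat.Partition.exists_diagram_eq {n : ℕ} (μ : YoungDiagram)
    (h : ∑ i ∈ Finset.range (μ.colLen 0), μ.rowLen i = n) :
    ∃ p : n.Partition, p.diagram = μ := by
  refine ⟨⟨μ.rowLens, fun hi => μ.pos_of_mem_rowLens _ (by simpa using hi), ?_⟩, ?_⟩
  · rw [← h, YoungDiagram.rowLens, ← Multiset.map_coe]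
    rfl
  · have h : (μ.rowLens : Multiset ℕ).sort (· ≥ ·) = μ.rowLens :=
      List.mergeSort_eq_self _ (μ.rowLens_sorted.pairwise)
    simp only [Nat.Partition.diagram, h]
    exact YoungDiagram.ofRowLens_to_rowLens_eq_self

theorem YoungDiagram.exists_rowLen_eq (f : ℕ → ℕ) (hf : Antitone f) (L : ℕ)
    (hL : ∀ i, L ≤ i → f i = 0) : ∃ μ : YoungDiagram, ∀ i, μ.rowLen i = f i := by
  have hmem : ∀ i j, (i, j) ∈ (Finset.range L ×ˢ Finset.range (f 0)).filter
      (fun c => c.2 < f c.1) ↔ j < f i := by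
    intro i j
    simp only [Finset.mem_filter, Finset.mem_product, Finset.mem_range, and_iff_right_iff_imp]
    intro hj
    refine ⟨?_, hj.trans_le (hf (Nat.zero_le i))⟩
    by_contra hi
    rw [hL i (not_lt.mp hi)] at hj
    exact absurd hj (Nat.not_lt_zero _)
  refine ⟨⟨(Finset.range L ×ˢ Finset.range (f 0)).filter (fun c => c.2 < f c.1), ?_⟩, ?_⟩
  · rintro ⟨i, j⟩ ⟨i', j'⟩ ⟨hi : i' ≤ i, hj : j' ≤ j⟩ h
    rw [Finset.mem_coe, hmem] at h ⊢
    exact hj.trans_lt (h.trans_le (hf hi))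
  · intro i
    refine eq_of_forall_lt_iff fun j => ?_
    exact YoungDiagram.mem_iff_lt_rowLen.symm.trans (hmem i j)

/-! ### The bead set of a Young diagram -/

/-- The position of the bead of the `i`-th row. -/
def YoungDiagram.bead (μ : YoungDiagram) (i : ℕ) : ℤ := μ.rowLen i - i - 1

/-- The position of the gap of the `j`-th column. -/
def YoungDiagram.gap (μ : YoungDiagram) (j : ℕ) : ℤ := j - μ.colLen j

theorem YoungDiagram.bead_strictAnti (μ : YoungDiagram) : StrictAnti μ.bead := by
  intro i j hij
  have := μ.rowLen_anti i j hij.le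
  simp only [YoungDiagram.bead]
  omega

theorem YoungDiagram.gap_lt_bead_iff (μ : YoungDiagram) (i j : ℕ) :
    μ.gap j < μ.bead i ↔ (i, j) ∈ μ := by
  have h1 := μ.mem_iff_lt_rowLen (i := i) (j := j)
  have h2 := μ.mem_iff_lt_colLen (i := i) (j := j)
  simp only [YoungDiagram.bead, YoungDiagram.gap]
  by_cases h : (i, j) ∈ μ
  · have := h1.mp h
    have := h2.mp h
    exact iff_of_true (by omega) h
  · have := mt h1.mpr h
    have := mt h2.mpr h
    exact iff_of_false (by omega) h

theorem YoungDiagram.gap_ne_bead (μ : YoungDiagram) (i j : ℕ) : μ.gap j ≠ μ.bead i := by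
  have h1 := μ.mem_iff_lt_rowLen (i := i) (j := j)
  have h2 := μ.mem_iff_lt_colLen (i := i) (j := j)
  simp only [YoungDiagram.bead, YoungDiagram.gap]
  by_cases h : (i, j) ∈ μ
  · have := h1.mp h
    have := h2.mp h
    omega
  · have := mt h1.mpr h
    have := mt h2.mpr h
    omega

/-- With `gap_ne_bead`, this makes beads and gaps partition ℤ. If `i` is the first row whose bead
lies below `y`, column `y + i` has height exactly `i`. -/
theorem YoungDiagram.exists_gap_eq (μ : YoungDiagram) {y : ℤ} (hy : ∀ i, μ.bead i ≠ y) :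
    ∃ j, μ.gap j = y := by
  classical
  have hex : ∃ i, μ.bead i < y := by
    refine ⟨μ.rowLen 0 + y.natAbs, ?_⟩
    have := μ.rowLen_anti 0 (μ.rowLen 0 + y.natAbs) (Nat.zero_le _)
    simp only [YoungDiagram.bead]
    omega
  obtain ⟨i, hi, hmin⟩ : ∃ i, μ.bead i < y ∧ ∀ k < i, y < μ.bead k :=
    ⟨Nat.find hex, Nat.find_spec hex, fun k hk =>
      lt_of_le_of_ne (not_lt.mp (Nat.find_min hex hk)) (hy k).symm⟩
  have hj : 0 ≤ y + i := by
    simp only [YoungDiagram.bead] at hi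
    omega
  obtain ⟨j, hj⟩ := Int.eq_ofNat_of_zero_le hj
  refine ⟨j, ?_⟩
  have h1 : ¬ i < μ.colLen j := by
    rw [← YoungDiagram.mem_iff_lt_colLen, YoungDiagram.mem_iff_lt_rowLen]
    simp only [YoungDiagram.bead] at hi
    omega
  have h2 : μ.colLen j = i := by
    refine le_antisymm (not_lt.mp h1) ?_
    rcases Nat.eq_zero_or_pos i with h0 | h0
    · omega
    have h3 := hmin (i - 1) (by omega)
    have h4 : i - 1 < μ.colLen j := by
      rw [← YoungDiagram.mem_iff_lt_colLen, YoungDiagram.mem_iff_lt_rowLen]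
      simp only [YoungDiagram.bead] at h3
      omega
    omega
  simp only [YoungDiagram.gap, h2]
  omega

theorem YoungDiagram.hookLength_eq (μ : YoungDiagram) {i j : ℕ} (h : (i, j) ∈ μ) :
    (μ.hookLength i j : ℤ) = μ.bead i - μ.gap j := by
  have h1 := μ.mem_iff_lt_rowLen.mp h
  have h2 := μ.mem_iff_lt_colLen.mp h
  simp only [YoungDiagram.hookLength, YoungDiagram.bead, YoungDiagram.gap]
  omega

/-- A set of beads is `s (mod t)`-closed if moving a bead down by `s + k * t` always ends on a
bead. -/
def IsModClosed (s t : ℕ) (X : Set ℤ) : Prop :=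
  ∀ x ∈ X, ∀ k : ℕ, x - (s + k * t : ℕ) ∈ X

theorem Nat.Partition.isModCore_iff {n s t : ℕ} (hs : 0 < s) (p : n.Partition) :
    p.IsModCore s t ↔ IsModClosed s t (Set.range p.diagram.bead) := by
  constructor
  · rintro h _ ⟨i, rfl⟩ k
    by_contra hX
    obtain ⟨j, hj⟩ := p.diagram.exists_gap_eq (y := p.diagram.bead i - (s + k * t : ℕ))
      fun i' hi' => hX ⟨i', hi'⟩
    have hmem : (i, j) ∈ p.diagram := by
      rw [← YoungDiagram.gap_lt_bead_iff, hj]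
      have : 0 < s + k * t := by omega
      omega
    refine h i j hmem k ?_
    have := p.diagram.hookLength_eq hmem
    rw [hj] at this
    omega
  · intro h i j hmem k hk
    obtain ⟨i', hi'⟩ := h _ ⟨i, rfl⟩ k
    have := p.diagram.hookLength_eq hmem
    refine p.diagram.gap_ne_bead i' j ?_
    rw [hi']
    rw [hk] at this
    omega

theorem YoungDiagram.rowLen_injective : Function.Injective YoungDiagram.rowLen := by
  intro μ ν h
  ext ⟨i, j⟩
  rw [YoungDiagram.mem_cells, YoungDiagram.mem_cells, YoungDiagram.mem_iff_lt_rowLen, h,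
    YoungDiagram.mem_iff_lt_rowLen]

theorem YoungDiagram.range_bead_injective :
    Function.Injective fun μ : YoungDiagram => Set.range μ.bead := by
  intro μ ν h
  -- A strictly monotone sequence is determined by its range; negation turns the decreasing beads
  -- into one.
  have hmono : ∀ μ : YoungDiagram, StrictMono fun i => -μ.bead i :=
    fun μ i j hij => neg_lt_neg (μ.bead_strictAnti hij)
  have hr : Set.range (fun i => -μ.bead i) = Set.range (fun i => -ν.bead i) := by
    ext x
    have := Set.ext_iff.mp h (-x)
    simpa [neg_eq_iff_eq_neg] using this
  have h2 := ((hmono μ).range_inj (hmono ν)).mp hr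
  refine YoungDiagram.rowLen_injective (funext fun i => ?_)
  have := congrFun h2 i
  simp only [YoungDiagram.bead] at this
  omega
/-! ### Counting lattice points -/

/-- The sizes of the three `2 (mod 3)`-cores. -/
def coreSize : Fin 3 → ℤ := ![0, 1, 3]

/-- The energy of the abacus configuration with charges `-a - b, a, b` and core shapes `e`. -/
def latticeEnergy (x : (ℤ × ℤ) × (Fin 3 × Fin 3 × Fin 3)) : ℤ :=
  3 * (x.1.1 ^ 2 + x.1.1 * x.1.2 + x.1.2 ^ 2) + x.1.1 + 2 * x.1.2 +
    3 * (coreSize x.2.1 + coreSize x.2.2.1 + coreSize x.2.2.2)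

/-- Cyclic rotation of the three shapes. -/
def rotateShapes (x : (ℤ × ℤ) × (Fin 3 × Fin 3 × Fin 3)) : (ℤ × ℤ) × (Fin 3 × Fin 3 × Fin 3) :=
  (x.1, x.2.2.1, x.2.2.2, x.2.1)

/-- An involution on triples of shapes that preserves the total size and fixes no triple of total
size `3`. -/
def flipShapes (e : Fin 3 × Fin 3 × Fin 3) : Fin 3 × Fin 3 × Fin 3 :=
  if e = (1, 1, 1) then (0, 2, 0) else if e = (0, 2, 0) then (1, 1, 1) else (e.2.2, e.2.1, e.1)

/-- Conjugation on the charges together with `flipShapes` on the shapes. -/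
def flipLattice (x : (ℤ × ℤ) × (Fin 3 × Fin 3 × Fin 3)) : (ℤ × ℤ) × (Fin 3 × Fin 3 × Fin 3) :=
  ((-x.1.1, x.1.1 + x.1.2), flipShapes x.2)

theorem latticeEnergy_rotateShapes (x : (ℤ × ℤ) × (Fin 3 × Fin 3 × Fin 3)) :
    latticeEnergy (rotateShapes x) = latticeEnergy x := by
  simp only [latticeEnergy, rotateShapes]
  ring

theorem flipShapes_flipShapes : ∀ e, flipShapes (flipShapes e) = e := by decide

theorem coreSize_flipShapes : ∀ e, coreSize (flipShapes e).1 + coreSize (flipShapes e).2.1 +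
    coreSize (flipShapes e).2.2 = coreSize e.1 + coreSize e.2.1 + coreSize e.2.2 := by decide

/-- The point is that 3 is absent: 12 - 9·3 ≡ 1 is a square mod 16, so a fixed triple of size 3
would spoil the parity argument. -/
theorem coreSize_of_flipShapes_eq : ∀ e, flipShapes e = e →
    coreSize e.1 + coreSize e.2.1 + coreSize e.2.2 ∈ ({0, 1, 2, 5, 6, 7, 9} : Finset ℤ) := by
  decide

theorem latticeEnergy_flipLattice (x : (ℤ × ℤ) × (Fin 3 × Fin 3 × Fin 3)) :
    latticeEnergy (flipLattice x) = latticeEnergy x := by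
  simp only [latticeEnergy, flipLattice, coreSize_flipShapes]
  ring

theorem flipLattice_flipLattice (x : (ℤ × ℤ) × (Fin 3 × Fin 3 × Fin 3)) :
    flipLattice (flipLattice x) = x := by
  simp [flipLattice, flipShapes_flipShapes]

/-- If a map of prime order `p` preserves an energy and has no fixed point of energy `n`, then the
number of points of energy `n` is divisible by `p`. -/
theorem natCard_modEq_zero_of_iterate {α : Type*} (p : ℕ) [Fact p.Prime] (E : α → ℤ) (f : α → α)
    (hE : ∀ x, E (f x) = E x) (hf : f^[p] = id) (n : ℤ) (hfix : ∀ x, f x = x → E x ≠ n)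
    [Finite {x // E x = n}] : Nat.card {x // E x = n} ≡ 0 [MOD p] := by
  classical
  have := Fintype.ofFinite {x // E x = n}
  let g : Function.End {x // E x = n} := fun x => ⟨f x.1, (hE x.1).trans x.2⟩
  have hg : ∀ k (x : {x // E x = n}), ((g ^ k) x).1 = f^[k] x.1 := by
    intro k
    induction k with
    | zero => intro x; rfl
    | succ k ih =>
      intro x
      rw [pow_succ, Function.iterate_succ_apply]
      exact ih (g x)
  have h1 : g ^ p ^ 1 = 1 := by
    funext x
    apply Subtype.ext
    rw [pow_one, hg, hf]
    rfl
  have h2 := Equiv.Perm.card_fixedPoints_modEq h1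
  have h3 : IsEmpty g.fixedPoints :=
    ⟨fun x => hfix x.1.1 (congrArg Subtype.val x.2) x.1.2⟩
  rw [Nat.card_eq_fintype_card]
  exact h2.trans (by rw [Fintype.card_eq_zero (α := g.fixedPoints)])

/-- 2 and 5 are inert in the Eisenstein integers, so norms have even valuation at both; the excluded
residues here and mod 25 have odd valuation. -/
theorem norm_ne_zmod_sixteen : ∀ u v : ZMod 16, u ^ 2 + u * v + v ^ 2 ≠ 8 ∧
    u ^ 2 + u * v + v ^ 2 ≠ 2 ∧ u ^ 2 + u * v + v ^ 2 ≠ 14 := by decide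

set_option maxRecDepth 10000 in
theorem norm_ne_zmod_twentyFive : ∀ u v : ZMod 25, u ^ 2 + u * v + v ^ 2 ≠ 5 ∧
    u ^ 2 + u * v + v ^ 2 ≠ 10 ∧ u ^ 2 + u * v + v ^ 2 ≠ 15 ∧ u ^ 2 + u * v + v ^ 2 ≠ 20 := by
  decide

theorem sq_mem_zmod_sixteen : ∀ u : ZMod 16, u ^ 2 ∈ ({0, 1, 4, 9} : Finset (ZMod 16)) := by
  decide

theorem natCard_latticeEnergy_modEq_two (n : ℕ) [Finite {x // latticeEnergy x = (16 * n + 9 : ℕ)}] :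
    Nat.card {x // latticeEnergy x = (16 * n + 9 : ℕ)} ≡ 0 [MOD 2] := by
  refine natCard_modEq_zero_of_iterate 2 latticeEnergy flipLattice latticeEnergy_flipLattice
    (funext flipLattice_flipLattice) _ ?_
  rintro ⟨⟨a, b⟩, e⟩ hx hE
  simp only [flipLattice, Prod.mk.injEq] at hx
  obtain ⟨⟨ha, -⟩, he⟩ := hx
  have ha : a = 0 := by omega
  subst ha
  have hs := coreSize_of_flipShapes_eq e he
  simp only [latticeEnergy] at hE
  generalize coreSize e.1 + coreSize e.2.1 + coreSize e.2.2 = w at hs hE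
  -- Tripling the energy equation and adding 1 completes the square.
  have h1 : (3 * b + 1) ^ 2 = 16 * (3 * n + 1) + 12 - 9 * w := by
    push_cast at hE
    linear_combination 3 * hE
  have h2 : ((3 * b + 1 : ℤ) : ZMod 16) ^ 2 = 12 - 9 * (w : ZMod 16) := by
    have := congrArg (Int.cast : ℤ → ZMod 16) h1
    push_cast at this ⊢
    rw [this, show (16 : ZMod 16) = 0 from rfl]
    ring
  have h3 := sq_mem_zmod_sixteen ((3 * b + 1 : ℤ) : ZMod 16)
  rw [h2] at h3
  simp only [Finset.mem_insert, Finset.mem_singleton] at hs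
  rcases hs with rfl | rfl | rfl | rfl | rfl | rfl | rfl <;> revert h3 <;> decide

theorem natCard_latticeEnergy_modEq_three (k : ℕ)
    (hk : k ∈ ({38, 88, 118, 168, 198, 248, 278, 328} : Finset ℕ)) (n : ℕ)
    [Finite {x // latticeEnergy x = (400 * n + k : ℕ)}] :
    Nat.card {x // latticeEnergy x = (400 * n + k : ℕ)} ≡ 0 [MOD 3] := by
  refine natCard_modEq_zero_of_iterate 3 latticeEnergy rotateShapes latticeEnergy_rotateShapes
    rfl _ ?_
  rintro ⟨⟨a, b⟩, e0, e1, e2⟩ hx hE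
  simp only [rotateShapes, Prod.mk.injEq, true_and] at hx
  obtain ⟨rfl, rfl, -⟩ := hx
  simp only [latticeEnergy] at hE
  have h1 : (3 * a) ^ 2 + (3 * a) * (3 * b + 1) + (3 * b + 1) ^ 2 =
      1200 * n + 3 * k + 1 - 27 * coreSize e2 := by
    push_cast at hE
    linear_combination 3 * hE
  have h16 := congrArg (Int.cast : ℤ → ZMod 16) h1
  have h25 := congrArg (Int.cast : ℤ → ZMod 25) h1
  push_cast at h16 h25
  rw [show (1200 : ZMod 16) = 0 from rfl, zero_mul, zero_add] at h16
  rw [show (1200 : ZMod 25) = 0 from rfl, zero_mul, zero_add] at h25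
  have n16 := norm_ne_zmod_sixteen (3 * a) (3 * b + 1)
  have n25 := norm_ne_zmod_twentyFive (3 * a) (3 * b + 1)
  rw [h16] at n16
  rw [h25] at n25
  clear h16 h25 h1 hE
  simp only [Finset.mem_insert, Finset.mem_singleton] at hk
  -- Shape ∅ is excluded mod 25, the shapes of sizes 1 and 3 mod 16.
  rcases hk with rfl | rfl | rfl | rfl | rfl | rfl | rfl | rfl <;> fin_cases e2 <;>
    first
    | (revert n16; decide)
    | (revert n25; decide)

/-! ### Charge and energy of a set of beads -/

/-- The indicator function of `X` minus that of the negative integers. -/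
noncomputable def beadExcess (X : Set ℤ) (x : ℤ) : ℤ :=
  X.indicator (fun _ => 1) x - (Set.Iio 0).indicator (fun _ => 1) x

/-- The sum of `g` over `X`, normalized by the sum of `g` over the negative integers, is `s`. -/
def HasMoment (g : ℤ → ℤ) (X : Set ℤ) (s : ℤ) : Prop :=
  HasSum (fun x => g x * beadExcess X x) s

theorem HasMoment.unique {g : ℤ → ℤ} {X : Set ℤ} {s t : ℤ} (h : HasMoment g X s)
    (h' : HasMoment g X t) : s = t :=
  HasSum.unique h h'

theorem HasMoment.insert {g : ℤ → ℤ} {X : Set ℤ} {s a : ℤ} (h : HasMoment g X s) (ha : a ∉ X) :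
    HasMoment g (insert a X) (s + g a) := by
  classical
  refine (HasSum.add h (hasSum_ite_eq a (g a))).congr_fun fun x => ?_
  simp only [beadExcess, Set.indicator_apply, Set.mem_insert_iff]
  by_cases hx : x = a
  · subst hx
    simp only [ha, or_false, if_true, if_false]
    ring
  · simp only [hx, false_or, if_false, add_zero]

theorem HasMoment.erase {g : ℤ → ℤ} {X : Set ℤ} {s a : ℤ} (h : HasMoment g X s) (ha : a ∈ X) :
    HasMoment g (X \ {a}) (s - g a) := by
  classical
  refine (HasSum.sub h (hasSum_ite_eq a (g a))).congr_fun fun x => ?_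
  simp only [beadExcess, Set.indicator_apply, Set.mem_sdiff, Set.mem_singleton_iff]
  by_cases hx : x = a
  · subst hx
    simp only [ha, not_true_eq_false, and_false, if_true, if_false]
    ring
  · simp only [hx, not_false_eq_true, and_true, if_false, sub_zero]

theorem hasMoment_Iio {g G : ℤ → ℤ} (h0 : G 0 = 0) (hG : ∀ c, G (c + 1) = G c + g c) (c : ℤ) :
    HasMoment g (Set.Iio c) (G c) := by
  induction c using Int.induction_on with
  | zero => simp [HasMoment, beadExcess, h0, hasSum_zero]
  | succ i ih =>
    have h := ih.insert (a := (i : ℤ)) (by simp)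
    rw [hG]
    convert h using 1
    ext x
    simp only [Set.mem_Iio, Set.mem_insert_iff]
    omega
  | pred i ih =>
    have h := ih.erase (a := -(i : ℤ) - 1) (by simp)
    have h1 := hG (-(i : ℤ) - 1)
    rw [sub_add_cancel] at h1
    rw [h1, add_sub_cancel_right] at h
    convert h using 1
    ext x
    simp only [Set.mem_Iio, Set.mem_sdiff, Set.mem_singleton_iff]
    omega

/-- From index `L` on the beads fill the ray below `k - L`, with moment `G (k - L)`; the first `L`
beads are then inserted one at a time. -/
theorem hasMoment_range {g G : ℤ → ℤ} (h0 : G 0 = 0) (hG : ∀ c, G (c + 1) = G c + g c)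
    {b : ℕ → ℤ} (hb : StrictAnti b) {k : ℤ} {L : ℕ} (hL : ∀ i, L ≤ i → b i = k - i - 1) :
    HasMoment g (Set.range b) (G (k - L) + ∑ i ∈ Finset.range L, g (b i)) := by
  have hlow : ∀ i < L, k - L ≤ b i := by
    intro i hi
    have h1 := hb hi
    rw [hL L le_rfl] at h1
    omega
  have key : ∀ m ≤ L, HasMoment g (Set.Iio (k - L) ∪ b '' Set.Iio m)
      (G (k - L) + ∑ i ∈ Finset.range m, g (b i)) := by
    intro m
    induction m with
    | zero =>
      intro _
      simpa using hasMoment_Iio h0 hG (k - L)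
    | succ m ih =>
      intro hm
      have h := (ih (by omega)).insert (a := b m) ?_
      · rw [Finset.sum_range_succ, ← add_assoc]
        convert h using 1
        ext x
        simp only [Set.mem_union, Set.mem_insert_iff, Set.mem_image, Set.mem_Iio,
          Nat.lt_succ_iff_lt_or_eq, or_and_right, exists_or, exists_eq_left]
        rw [eq_comm (a := x)]
        rw [← or_assoc, or_comm]
      · rintro (h | ⟨i, hi, h⟩)
        · exact absurd h (not_lt.mpr (hlow m (by omega)))
        · exact absurd (hb.injective h) (ne_of_lt hi)
  convert key L le_rfl using 1
  ext x
  simp only [Set.mem_range, Set.mem_union, Set.mem_image, Set.mem_Iio]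
  constructor
  · rintro ⟨i, rfl⟩
    rcases lt_or_ge i L with hi | hi
    · exact Or.inr ⟨i, hi, rfl⟩
    · left
      rw [hL i hi]
      omega
  · rintro (h | ⟨i, -, h⟩)
    · refine ⟨(k - x - 1).toNat, ?_⟩
      rw [hL _ (by omega)]
      omega
    · exact ⟨i, h⟩

/-- The sum of the integers in `[0, c)`, extended to negative `c`. -/
def triangle (c : ℤ) : ℤ := c * (c - 1) / 2

theorem two_mul_triangle (c : ℤ) : 2 * triangle c = c * (c - 1) :=
  Int.mul_ediv_cancel' (Int.even_mul_pred_self c).two_dvd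

theorem triangle_add_one (c : ℤ) : triangle (c + 1) = triangle c + c := by
  have h1 := two_mul_triangle c
  have h2 := two_mul_triangle (c + 1)
  have h3 : (c + 1) * (c + 1 - 1) = c * (c - 1) + 2 * c := by ring
  omega

theorem hasMoment_one_range {b : ℕ → ℤ} (hb : StrictAnti b) {k : ℤ} {L : ℕ}
    (hL : ∀ i, L ≤ i → b i = k - i - 1) : HasMoment (fun _ => 1) (Set.range b) k := by
  simpa using hasMoment_range (g := fun _ => 1) (G := id) rfl (fun _ => rfl) hb hL

theorem YoungDiagram.bead_of_colLen_le (μ : YoungDiagram) {i : ℕ} (hi : μ.colLen 0 ≤ i) :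
    μ.bead i = 0 - i - 1 := by
  have h1 : ¬ i < μ.colLen 0 := not_lt.mpr hi
  rw [← YoungDiagram.mem_iff_lt_colLen, YoungDiagram.mem_iff_lt_rowLen] at h1
  simp only [YoungDiagram.bead]
  omega

theorem YoungDiagram.hasMoment_one_bead (μ : YoungDiagram) :
    HasMoment (fun _ => 1) (Set.range μ.bead) 0 :=
  hasMoment_one_range μ.bead_strictAnti fun _ => μ.bead_of_colLen_le

theorem YoungDiagram.hasMoment_id_bead (μ : YoungDiagram) :
    HasMoment id (Set.range μ.bead) (∑ i ∈ Finset.range (μ.colLen 0), μ.rowLen i : ℕ) := by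
  have h := hasMoment_range (g := id) rfl triangle_add_one μ.bead_strictAnti
    fun _ => μ.bead_of_colLen_le
  convert h using 1
  -- The triangle term cancels the shifts `-i - 1`, so the energy is the size of the partition.
  have hsum : ∀ L : ℕ, ((∑ i ∈ Finset.range L, μ.rowLen i : ℕ) : ℤ) =
      triangle (0 - L) + ∑ i ∈ Finset.range L, id (μ.bead i) := by
    intro L
    induction L with
    | zero => simp [triangle]
    | succ L ih =>
      have h1 := triangle_add_one (0 - (L + 1 : ℕ))
      rw [show (0 - ((L + 1 : ℕ) : ℤ) + 1) = 0 - L by push_cast; ring] at h1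
      rw [Finset.sum_range_succ, Finset.sum_range_succ, Nat.cast_add, ih, h1]
      simp only [YoungDiagram.bead, id]
      push_cast
      ring
  exact hsum _

/-! ### Bead sets of charge zero come from Young diagrams -/

theorem exists_strictAnti_range_eq {X : Set ℤ} {M T : ℤ} (hM : ∀ x ∈ X, x ≤ M)
    (hT : ∀ x ≤ T, x ∈ X) : ∃ b : ℕ → ℤ, StrictAnti b ∧ Set.range b = X := by
  classical
  have hinf : (Set.ofPred fun m : ℕ => M - m ∈ X).Infinite := by
    refine Set.infinite_of_not_bddAbove ?_
    rintro ⟨B, hB⟩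
    have : B + (M - T).natAbs + 1 ≤ B := hB (hT _ (by omega))
    omega
  refine ⟨fun i => M - Nat.nth (fun m : ℕ => M - m ∈ X) i, ?_, ?_⟩
  · intro i j hij
    have := Nat.nth_strictMono hinf hij
    simp only
    omega
  · ext x
    have hr := Nat.range_nth_of_infinite hinf
    constructor
    · rintro ⟨i, rfl⟩
      exact Nat.nth_mem_of_infinite hinf i
    · intro hx
      have h1 : (M - x).toNat ∈ Set.range (Nat.nth fun m : ℕ => M - m ∈ X) := by
        rw [hr]
        have := hM x hx
        change M - ((M - x).toNat : ℤ) ∈ X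
        rwa [Int.toNat_of_nonneg (by omega), sub_sub_cancel]
      obtain ⟨i, hi⟩ := h1
      refine ⟨i, ?_⟩
      have := hM x hx
      simp only [hi]
      omega

theorem exists_eventually_eq_of_strictAnti {b : ℕ → ℤ} (hb : StrictAnti b) {T : ℤ}
    (hT : ∀ x ≤ T, x ∈ Set.range b) : ∃ (k : ℤ) (L : ℕ), ∀ i, L ≤ i → b i = k - i - 1 := by
  obtain ⟨L, hL⟩ := hT T le_rfl
  refine ⟨T + L + 1, L, fun i hi => ?_⟩
  induction i, hi using Nat.le_induction with
  | base => omega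
  | succ i hi ih =>
    obtain ⟨j, hj⟩ := hT (b i - 1) (by omega)
    have h1 : i < j := hb.lt_iff_gt.mp (by omega)
    have h2 : b j ≤ b (i + 1) := hb.antitone h1
    have h3 := hb (Nat.lt_add_one i)
    push_cast
    omega

theorem YoungDiagram.exists_range_bead_eq {X : Set ℤ} {M T : ℤ} (hM : ∀ x ∈ X, x ≤ M)
    (hT : ∀ x ≤ T, x ∈ X) (h0 : HasMoment (fun _ => 1) X 0) :
    ∃ μ : YoungDiagram, Set.range μ.bead = X := by
  obtain ⟨b, hb, rfl⟩ := exists_strictAnti_range_eq hM hT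
  obtain ⟨k, L, hL⟩ := exists_eventually_eq_of_strictAnti hb hT
  -- Charge zero makes the row lengths `b i + i + 1` vanish eventually.
  obtain rfl : 0 = k := h0.unique (hasMoment_one_range hb hL)
  have hanti : Antitone fun i => b i + i + 1 := by
    refine antitone_nat_of_succ_le fun i => ?_
    have := hb (Nat.lt_add_one i)
    push_cast
    omega
  have hnonneg : ∀ i, 0 ≤ b i + i + 1 := by
    intro i
    have h1 := hanti (le_max_left i L)
    have h2 := hL _ (le_max_right i L)
    simp only at h1
    omega
  obtain ⟨μ, hμ⟩ := YoungDiagram.exists_rowLen_eq (fun i => (b i + i + 1).toNat)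
    (fun i j hij => Int.toNat_le_toNat (hanti hij)) L (fun i hi => by
      have := hL i hi
      omega)
  refine ⟨μ, congrArg Set.range (funext fun i => ?_)⟩
  have := hnonneg i
  simp only [YoungDiagram.bead, hμ]
  omega

/-! ### Splitting a set of beads into its three runners -/

/-- The beads of `X` in the residue class of `r` modulo `3`. -/
def beadRunner (X : Set ℤ) (r : ℤ) : Set ℤ := {m | 3 * m + r ∈ X}

theorem hasSum_of_residues {f : ℤ → ℤ} {s₀ s₁ s₂ : ℤ} (h₀ : HasSum (fun m => f (3 * m + 0)) s₀)
    (h₁ : HasSum (fun m => f (3 * m + 1)) s₁) (h₂ : HasSum (fun m => f (3 * m + 2)) s₂) :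
    HasSum f (s₀ + s₁ + s₂) := by
  have key : ∀ (r s : ℤ), 0 ≤ r → r < 3 → HasSum (fun m => f (3 * m + r)) s →
      HasSum (fun x => if x % 3 = r then f x else 0) s := by
    intro r s hr hr' h
    have hinj : Function.Injective fun m : ℤ => 3 * m + r := by
      intro a b hab
      simp only at hab
      omega
    refine (hinj.hasSum_iff ?_).mp (h.congr_fun fun m => ?_)
    · intro x hx
      refine if_neg fun hxr => hx ⟨x / 3, ?_⟩
      simp only
      omega
    · exact if_pos (show (3 * m + r) % 3 = r by omega)
  refine (((key 0 s₀ (by norm_num) (by norm_num) h₀).add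
    (key 1 s₁ (by norm_num) (by norm_num) h₁)).add
    (key 2 s₂ (by norm_num) (by norm_num) h₂)).congr_fun fun x => ?_
  have h : x % 3 = 0 ∨ x % 3 = 1 ∨ x % 3 = 2 := by omega
  rcases h with h | h | h <;> simp [h]

theorem beadExcess_beadRunner (X : Set ℤ) {r : ℤ} (hr : 0 ≤ r) (hr' : r < 3) (m : ℤ) :
    beadExcess X (3 * m + r) = beadExcess (beadRunner X r) m := by
  classical
  have h : 3 * m + r < 0 ↔ m < 0 := by omega
  simp only [beadExcess, Set.indicator_apply, Set.mem_Iio, h]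
  rfl

theorem hasMoment_one_of_runners {X : Set ℤ} {c₀ c₁ c₂ : ℤ}
    (h₀ : HasMoment (fun _ => 1) (beadRunner X 0) c₀)
    (h₁ : HasMoment (fun _ => 1) (beadRunner X 1) c₁)
    (h₂ : HasMoment (fun _ => 1) (beadRunner X 2) c₂) :
    HasMoment (fun _ => 1) X (c₀ + c₁ + c₂) := by
  refine hasSum_of_residues (h₀.congr_fun fun m => ?_) (h₁.congr_fun fun m => ?_)
    (h₂.congr_fun fun m => ?_) <;> rw [beadExcess_beadRunner] <;> norm_num

theorem hasMoment_id_of_runners {X : Set ℤ} {c₀ c₁ c₂ E₀ E₁ E₂ : ℤ}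
    (h₀ : HasMoment (fun _ => 1) (beadRunner X 0) c₀)
    (h₁ : HasMoment (fun _ => 1) (beadRunner X 1) c₁)
    (h₂ : HasMoment (fun _ => 1) (beadRunner X 2) c₂)
    (k₀ : HasMoment id (beadRunner X 0) E₀) (k₁ : HasMoment id (beadRunner X 1) E₁)
    (k₂ : HasMoment id (beadRunner X 2) E₂) :
    HasMoment id X (3 * E₀ + 0 * c₀ + (3 * E₁ + 1 * c₁) + (3 * E₂ + 2 * c₂)) := by
  refine hasSum_of_residues (((k₀.mul_left 3).add (h₀.mul_left 0)).congr_fun fun m => ?_)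
    (((k₁.mul_left 3).add (h₁.mul_left 1)).congr_fun fun m => ?_)
    (((k₂.mul_left 3).add (h₂.mul_left 2)).congr_fun fun m => ?_) <;>
  · rw [beadExcess_beadRunner _ (by norm_num) (by norm_num), id, id]
    ring

theorem eq_of_beadRunner_eq {X Y : Set ℤ} (h₀ : beadRunner X 0 = beadRunner Y 0)
    (h₁ : beadRunner X 1 = beadRunner Y 1) (h₂ : beadRunner X 2 = beadRunner Y 2) : X = Y := by
  ext x
  have h : x = 3 * (x / 3) + 0 ∨ x = 3 * (x / 3) + 1 ∨ x = 3 * (x / 3) + 2 := by omega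
  rcases h with h | h | h <;> rw [h]
  · exact Set.ext_iff.mp h₀ (x / 3)
  · exact Set.ext_iff.mp h₁ (x / 3)
  · exact Set.ext_iff.mp h₂ (x / 3)

theorem isModClosed_iff_beadRunner (X : Set ℤ) : IsModClosed 6 9 X ↔
    IsModClosed 2 3 (beadRunner X 0) ∧ IsModClosed 2 3 (beadRunner X 1) ∧
      IsModClosed 2 3 (beadRunner X 2) := by
  have hsub : ∀ (m r : ℤ) (k : ℕ),
      3 * (m - (2 + k * 3 : ℕ)) + r = 3 * m + r - (6 + k * 9 : ℕ) := by
    intro m r k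
    push_cast
    ring
  constructor
  · intro h
    refine ⟨?_, ?_, ?_⟩ <;>
    · intro m hm k
      have := h _ hm k
      rwa [← hsub] at this
  · rintro ⟨h₀, h₁, h₂⟩ x hx k
    have h : x = 3 * (x / 3) + 0 ∨ x = 3 * (x / 3) + 1 ∨ x = 3 * (x / 3) + 2 := by omega
    rcases h with h | h | h <;> rw [h] at hx ⊢ <;> rw [← hsub]
    · exact h₀ _ hx k
    · exact h₁ _ hx k
    · exact h₂ _ hx k

/-! ### The bead sets of the `2 (mod 3)`-cores -/

/-- The bead set of charge `c` of the `2 (mod 3)`-core `∅`, `(1)` or `(2, 1)`. -/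
def coreRunner (c : ℤ) : Fin 3 → Set ℤ :=
  ![Set.Iio c, insert c (Set.Iio c \ {c - 1}), insert (c + 1) (Set.Iio c \ {c - 2})]

theorem mem_coreRunner_zero (c x : ℤ) : x ∈ coreRunner c 0 ↔ x < c := Iff.rfl

theorem mem_coreRunner_one (c x : ℤ) : x ∈ coreRunner c 1 ↔ x = c ∨ x < c ∧ x ≠ c - 1 := Iff.rfl

theorem mem_coreRunner_two (c x : ℤ) :
    x ∈ coreRunner c 2 ↔ x = c + 1 ∨ x < c ∧ x ≠ c - 2 := Iff.rfl

theorem hasMoment_coreRunner {g G : ℤ → ℤ} (h0 : G 0 = 0) (hG : ∀ c, G (c + 1) = G c + g c)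
    (c : ℤ) (e : Fin 3) : HasMoment g (coreRunner c e)
      (![G c, G c - g (c - 1) + g c, G c - g (c - 2) + g (c + 1)] e) := by
  have h := hasMoment_Iio h0 hG c
  fin_cases e
  · exact h
  · exact (h.erase (a := c - 1) (by simp)).insert (by simp)
  · exact (h.erase (a := c - 2) (by simp)).insert (by simp)

theorem hasMoment_one_coreRunner (c : ℤ) (e : Fin 3) :
    HasMoment (fun _ => 1) (coreRunner c e) c := by
  convert hasMoment_coreRunner (g := fun _ => 1) (G := id) rfl (fun _ => rfl) c e using 1
  fin_cases e <;> simp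

theorem hasMoment_id_coreRunner (c : ℤ) (e : Fin 3) :
    HasMoment id (coreRunner c e) (triangle c + coreSize e) := by
  convert hasMoment_coreRunner (g := id) (G := triangle) rfl triangle_add_one c e using 1
  fin_cases e <;> simp [coreSize] <;> ring

theorem coreSize_injective : Function.Injective coreSize := by decide

/-- The charge recovers `c`; the energy then recovers the shape, since the sizes 0, 1, 3 are
distinct. -/
theorem coreRunner_injective {c c' : ℤ} {e e' : Fin 3} (h : coreRunner c e = coreRunner c' e') :
    c = c' ∧ e = e' := by
  have h1 := hasMoment_one_coreRunner c e
  have h2 := hasMoment_id_coreRunner c e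
  rw [h] at h1 h2
  obtain rfl := h1.unique (hasMoment_one_coreRunner c' e')
  have h3 := add_left_cancel (h2.unique (hasMoment_id_coreRunner c e'))
  exact ⟨rfl, coreSize_injective h3⟩

theorem isModClosed_coreRunner (c : ℤ) (e : Fin 3) : IsModClosed 2 3 (coreRunner c e) := by
  intro x hx k
  fin_cases e
  · change x < c at hx
    change x - _ < c
    omega
  · change x = c ∨ x < c ∧ x ≠ c - 1 at hx
    change x - _ = c ∨ x - _ < c ∧ x - _ ≠ c - 1
    omega
  · change x = c + 1 ∨ x < c ∧ x ≠ c - 2 at hx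
    change x - _ = c + 1 ∨ x - _ < c ∧ x - _ ≠ c - 2
    omega

theorem coreRunner_bounds (c x : ℤ) (e : Fin 3) :
    (x ∈ coreRunner c e → x ≤ c + 1) ∧ (x ≤ c - 3 → x ∈ coreRunner c e) := by
  fin_cases e
  · change (x < c → _) ∧ (_ → x < c)
    omega
  · change (x = c ∨ x < c ∧ x ≠ c - 1 → _) ∧ (_ → x = c ∨ x < c ∧ x ≠ c - 1)
    omega
  · change (x = c + 1 ∨ x < c ∧ x ≠ c - 2 → _) ∧ (_ → x = c + 1 ∨ x < c ∧ x ≠ c - 2)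
    omega

/-- The top bead `M` forces `M - 2` and everything from `M - 4` down. Only `M - 1` and `M - 3` are
free, and the former forces the latter, leaving three cases. -/
theorem exists_coreRunner_eq {Y : Set ℤ} (hne : Y.Nonempty) {B : ℤ} (hB : ∀ y ∈ Y, y ≤ B)
    (hY : IsModClosed 2 3 Y) : ∃ c e, Y = coreRunner c e := by
  obtain ⟨M, hM, hmax⟩ := Int.exists_greatest_of_bdd (P := (· ∈ Y)) ⟨B, hB⟩ hne
  have step : ∀ x ∈ Y, ∀ y, y < x → (x - y) % 3 = 2 → y ∈ Y := by
    intro x hx y hyx hmod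
    have h := hY x hx ((x - y) / 3).toNat
    convert h using 1
    omega
  have h2 : M - 2 ∈ Y := step M hM _ (by omega) (by omega)
  have h4 : M - 4 ∈ Y := step _ h2 _ (by omega) (by omega)
  have hlow : ∀ y ≤ M - 4, y ∈ Y := by
    intro y hy
    have h : (M - y) % 3 = 2 ∨ (M - 2 - y) % 3 = 2 ∨ y = M - 4 ∨
        y < M - 4 ∧ (M - 4 - y) % 3 = 2 := by omega
    rcases h with h | h | h | h
    · exact step M hM y (by omega) h
    · exact step _ h2 y (by omega) h
    · rwa [h]
    · exact step _ h4 y h.1 h.2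
  by_cases h1 : M - 1 ∈ Y
  · have h3 : M - 3 ∈ Y := step _ h1 _ (by omega) (by omega)
    refine ⟨M + 1, 0, Set.ext fun y => ?_⟩
    rw [mem_coreRunner_zero]
    constructor
    · intro hy
      have := hmax y hy
      omega
    · intro hy
      have h : y ≤ M - 4 ∨ y = M - 3 ∨ y = M - 2 ∨ y = M - 1 ∨ y = M := by omega
      rcases h with h | rfl | rfl | rfl | rfl
      · exact hlow y h
      all_goals assumption
  · by_cases h3 : M - 3 ∈ Y
    · refine ⟨M, 1, Set.ext fun y => ?_⟩
      rw [mem_coreRunner_one]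
      constructor
      · intro hy
        have := hmax y hy
        have : y ≠ M - 1 := fun h => h1 (h ▸ hy)
        omega
      · intro hy
        have h : y ≤ M - 4 ∨ y = M - 3 ∨ y = M - 2 ∨ y = M := by omega
        rcases h with h | rfl | rfl | rfl
        · exact hlow y h
        all_goals assumption
    · refine ⟨M - 1, 2, Set.ext fun y => ?_⟩
      rw [mem_coreRunner_two]
      constructor
      · intro hy
        have := hmax y hy
        have : y ≠ M - 1 := fun h => h1 (h ▸ hy)
        have : y ≠ M - 3 := fun h => h3 (h ▸ hy)
        omega
      · intro hy
        have h : y ≤ M - 4 ∨ y = M - 2 ∨ y = M := by omega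
        rcases h with h | rfl | rfl
        · exact hlow y h
        all_goals assumption

/-! ### The bijection between cores and lattice points -/

/-- The bead set whose runners have charges `-a - b, a, b` and core shapes `e`. -/
def abacus (x : (ℤ × ℤ) × (Fin 3 × Fin 3 × Fin 3)) : Set ℤ :=
  {y | y % 3 = 0 ∧ y / 3 ∈ coreRunner (-x.1.1 - x.1.2) x.2.1 ∨
    y % 3 = 1 ∧ y / 3 ∈ coreRunner x.1.1 x.2.2.1 ∨ y % 3 = 2 ∧ y / 3 ∈ coreRunner x.1.2 x.2.2.2}

theorem beadRunner_abacus (x : (ℤ × ℤ) × (Fin 3 × Fin 3 × Fin 3)) :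
    beadRunner (abacus x) 0 = coreRunner (-x.1.1 - x.1.2) x.2.1 ∧
    beadRunner (abacus x) 1 = coreRunner x.1.1 x.2.2.1 ∧
    beadRunner (abacus x) 2 = coreRunner x.1.2 x.2.2.2 := by
  refine ⟨?_, ?_, ?_⟩ <;> ext m <;>
    simp only [beadRunner, abacus, Set.mem_ofPred_eq]
  · rw [show (3 * m + 0) % 3 = 0 by omega, show (3 * m + 0) / 3 = m by omega]
    simp
  · rw [show (3 * m + 1) % 3 = 1 by omega, show (3 * m + 1) / 3 = m by omega]
    simp
  · rw [show (3 * m + 2) % 3 = 2 by omega, show (3 * m + 2) / 3 = m by omega]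
    simp

theorem abacus_injective : Function.Injective abacus := by
  rintro ⟨⟨a, b⟩, e₀, e₁, e₂⟩ ⟨⟨a', b'⟩, e₀', e₁', e₂'⟩ h
  obtain ⟨h0, h1, h2⟩ := beadRunner_abacus ((a, b), e₀, e₁, e₂)
  rw [h] at h0 h1 h2
  obtain ⟨k0, k1, k2⟩ := beadRunner_abacus ((a', b'), e₀', e₁', e₂')
  obtain ⟨-, r0⟩ := coreRunner_injective (h0.symm.trans k0)
  obtain ⟨q1, r1⟩ := coreRunner_injective (h1.symm.trans k1)
  obtain ⟨q2, r2⟩ := coreRunner_injective (h2.symm.trans k2)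
  simp only at r0 q1 r1 q2 r2
  rw [r0, q1, r1, q2, r2]

theorem isModClosed_abacus (x : (ℤ × ℤ) × (Fin 3 × Fin 3 × Fin 3)) :
    IsModClosed 6 9 (abacus x) := by
  obtain ⟨h0, h1, h2⟩ := beadRunner_abacus x
  rw [isModClosed_iff_beadRunner, h0, h1, h2]
  exact ⟨isModClosed_coreRunner _ _, isModClosed_coreRunner _ _, isModClosed_coreRunner _ _⟩

theorem hasMoment_one_abacus (x : (ℤ × ℤ) × (Fin 3 × Fin 3 × Fin 3)) :
    HasMoment (fun _ => 1) (abacus x) 0 := by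
  obtain ⟨h0, h1, h2⟩ := beadRunner_abacus x
  have h := hasMoment_one_of_runners (h0 ▸ hasMoment_one_coreRunner _ _)
    (h1 ▸ hasMoment_one_coreRunner _ _) (h2 ▸ hasMoment_one_coreRunner _ _)
  convert h using 1
  ring

theorem hasMoment_id_abacus (x : (ℤ × ℤ) × (Fin 3 × Fin 3 × Fin 3)) :
    HasMoment id (abacus x) (latticeEnergy x) := by
  obtain ⟨h0, h1, h2⟩ := beadRunner_abacus x
  have h := hasMoment_id_of_runners (h0 ▸ hasMoment_one_coreRunner _ _)
    (h1 ▸ hasMoment_one_coreRunner _ _) (h2 ▸ hasMoment_one_coreRunner _ _)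
    (h0 ▸ hasMoment_id_coreRunner _ _) (h1 ▸ hasMoment_id_coreRunner _ _)
    (h2 ▸ hasMoment_id_coreRunner _ _)
  convert h using 1
  have t0 := two_mul_triangle (-x.1.1 - x.1.2)
  have t1 := two_mul_triangle x.1.1
  have t2 := two_mul_triangle x.1.2
  -- Doubling clears the integer division in `triangle`.
  refine mul_left_cancel₀ (two_ne_zero (α := ℤ)) ?_
  simp only [latticeEnergy]
  linear_combination -3 * t0 - 3 * t1 - 3 * t2

theorem exists_range_bead_eq_abacus (x : (ℤ × ℤ) × (Fin 3 × Fin 3 × Fin 3)) :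
    ∃ μ : YoungDiagram, Set.range μ.bead = abacus x := by
  have hb0 := fun y => coreRunner_bounds (-x.1.1 - x.1.2) y x.2.1
  have hb1 := fun y => coreRunner_bounds x.1.1 y x.2.2.1
  have hb2 := fun y => coreRunner_bounds x.1.2 y x.2.2.2
  have ha := le_abs_self x.1.1
  have ha' := neg_abs_le x.1.1
  have hb := le_abs_self x.1.2
  have hb' := neg_abs_le x.1.2
  refine YoungDiagram.exists_range_bead_eq (M := 3 * (|x.1.1| + |x.1.2|) + 6)
    (T := -3 * (|x.1.1| + |x.1.2|) - 12) ?_ ?_ (hasMoment_one_abacus x)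
  · rintro y (⟨-, h⟩ | ⟨-, h⟩ | ⟨-, h⟩)
    · have := (hb0 _).1 h
      omega
    · have := (hb1 _).1 h
      omega
    · have := (hb2 _).1 h
      omega
  · intro y hy
    have h : y % 3 = 0 ∨ y % 3 = 1 ∨ y % 3 = 2 := by omega
    rcases h with h | h | h
    · exact Or.inl ⟨h, (hb0 _).2 (by omega)⟩
    · exact Or.inr (Or.inl ⟨h, (hb1 _).2 (by omega)⟩)
    · exact Or.inr (Or.inr ⟨h, (hb2 _).2 (by omega)⟩)

theorem YoungDiagram.exists_abacus_eq (μ : YoungDiagram)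
    (h : IsModClosed 6 9 (Set.range μ.bead)) : ∃ x, Set.range μ.bead = abacus x := by
  have hbound : ∀ r, 0 ≤ r → ∀ m ∈ beadRunner (Set.range μ.bead) r, m ≤ μ.rowLen 0 := by
    rintro r hr m ⟨i, hi⟩
    have := μ.rowLen_anti 0 i (Nat.zero_le i)
    simp only [YoungDiagram.bead] at hi
    omega
  have hne : ∀ r, 0 ≤ r → r < 3 → (beadRunner (Set.range μ.bead) r).Nonempty := by
    intro r hr hr'
    refine ⟨-(μ.colLen 0) - 2, (-(3 * (-(μ.colLen 0) - 2) + r) - 1).toNat, ?_⟩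
    rw [μ.bead_of_colLen_le (by omega)]
    omega
  obtain ⟨k0, k1, k2⟩ := (isModClosed_iff_beadRunner _).mp h
  obtain ⟨c0, e0, h0⟩ := exists_coreRunner_eq
    (hne 0 (by norm_num) (by norm_num)) (hbound 0 (by norm_num)) k0
  obtain ⟨c1, e1, h1⟩ := exists_coreRunner_eq
    (hne 1 (by norm_num) (by norm_num)) (hbound 1 (by norm_num)) k1
  obtain ⟨c2, e2, h2⟩ := exists_coreRunner_eq
    (hne 2 (by norm_num) (by norm_num)) (hbound 2 (by norm_num)) k2
  -- A Young diagram has total charge zero, so two charges determine the third.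
  have hc : 0 = c0 + c1 + c2 := μ.hasMoment_one_bead.unique
    (hasMoment_one_of_runners (h0 ▸ hasMoment_one_coreRunner _ _)
      (h1 ▸ hasMoment_one_coreRunner _ _) (h2 ▸ hasMoment_one_coreRunner _ _))
  obtain rfl : c0 = -c1 - c2 := by omega
  obtain ⟨j0, j1, j2⟩ := beadRunner_abacus ((c1, c2), e0, e1, e2)
  exact ⟨((c1, c2), e0, e1, e2),
    eq_of_beadRunner_eq (h0.trans j0.symm) (h1.trans j1.symm) (h2.trans j2.symm)⟩

theorem nonempty_modCores_equiv_lattice (n : ℕ) :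
    Nonempty ({x // latticeEnergy x = n} ≃ {p : n.Partition // p.IsModCore 6 9}) := by
  have hex : ∀ x : {x // latticeEnergy x = n}, ∃ p : {p : n.Partition // p.IsModCore 6 9},
      Set.range p.1.diagram.bead = abacus x.1 := by
    intro x
    obtain ⟨μ, hμ⟩ := exists_range_bead_eq_abacus x.1
    have hsum : ((∑ i ∈ Finset.range (μ.colLen 0), μ.rowLen i : ℕ) : ℤ) = n := by
      rw [← x.2]
      exact μ.hasMoment_id_bead.unique (hμ ▸ hasMoment_id_abacus x.1)
    obtain ⟨p, rfl⟩ := Nat.Partition.exists_diagram_eq μ (Int.natCast_inj.mp hsum)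
    refine ⟨⟨p, ?_⟩, hμ⟩
    rw [p.isModCore_iff (by norm_num), hμ]
    exact isModClosed_abacus x.1
  choose f hf using hex
  refine ⟨Equiv.ofBijective f ⟨?_, ?_⟩⟩
  · intro x y hxy
    refine Subtype.ext (abacus_injective ?_)
    rw [← hf, ← hf, hxy]
  · rintro ⟨p, hp⟩
    obtain ⟨x, hx⟩ := p.diagram.exists_abacus_eq ((p.isModCore_iff (by norm_num)).mp hp)
    have hE : latticeEnergy x = n := by
      have h := p.diagram.hasMoment_id_bead
      rw [p.sum_rowLen_diagram, hx] at h
      exact (hasMoment_id_abacus x).unique h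
    refine ⟨⟨x, hE⟩, Subtype.ext (Nat.Partition.diagram_injective
      (YoungDiagram.range_bead_injective ?_))⟩
    exact (hf ⟨x, hE⟩).trans hx.symm

/-- Finiteness is inherited from the partitions of `n`, with no estimate on the quadratic form. -/
theorem finite_latticeEnergy (n : ℕ) : Finite {x // latticeEnergy x = n} :=
  Finite.of_equiv _ (nonempty_modCores_equiv_lattice n).some.symm

theorem numModCores_six_nine (n : ℕ) :
    numModCores 6 9 n = Nat.card {x // latticeEnergy x = n} :=
  Nat.card_congr (nonempty_modCores_equiv_lattice n).some.symm

theorem mainTheorem7 :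
    (∀ n : ℕ, numModCores 6 9 (16 * n + 9) ≡ 0 [MOD 2]) ∧
    (∀ k ∈ ({38, 88, 118, 168, 198, 248, 278, 328} : Finset ℕ), ∀ n : ℕ,
      numModCores 6 9 (400 * n + k) ≡ 0 [MOD 3]) := by
  refine ⟨fun n => ?_, fun k hk n => ?_⟩
  · have := finite_latticeEnergy (16 * n + 9)
    rw [numModCores_six_nine]
    exact natCard_latticeEnergy_modEq_two n
  · have := finite_latticeEnergy (400 * n + k)
    rw [numModCores_six_nine]
    exact natCard_latticeEnergy_modEq_three k hk n
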